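/- Consider a $T$-round online learning game on a finite directed graph $G=(V,E)$ (self-loops allowed) with $|V|\ge 2$, whose vertices are the player's actions. For $v\in V$ write $N^{\mathrm{in}}(v)=\{w:(w,v)\in E\}$. The graph $G$ is strongly-observable if every $v\in V$ satisfies $v\in N^{\mathrm{in}}(v)$ or $V\setminus\{v\}\subseteq N^{\mathrm{in}}(v)$, and non-revealing if $N^{\mathrm{in}}(u)\cap N^{\mathrm{in}}(v)=\emptyset$ for some $u,v\in V$. An oblivious adversary with switching costs fixes functions $\ell_1,\dots,\ell_T:V\to[0,1]$ in advance; the player, choosing actions $X_1,\dots,X_T$, incurs the losses $f_1(X_1)=\ell_1(X_1)$ and $f_t(X_{t-1},X_t)=\ell_t(X_t)+\mathbf 1_{\{X_t\ne X_{t-1}\}}$ for $t\ge 2$. The player knows $G$ and, after playing $X_t$, observes exactly the round-$t$ losses $f_t(X_{t-1},v)$ ($f_1(v)$ if $t=1$) of the actions $v$ with $(X_t,v)\in E$; a randomized strategy chooses $X_t$ as a function of internal randomness and of the past actions and observations. Its policy regret is $$R_T=\sum_{t=1}^T f_t(X_{t-1},X_t)-\min_{x\in V}\sum_{t=1}^T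 f_t(x,x)=\sum_{t=1}^T\ell_t(X_t)+\sum_{t=2}^T\mathbf 1_{\{X_t\neq X_{t-1}\}}-\min_{x\in V}\sum_{t=1}^T\ell_t(x),$$ where $f_1(\cdot,x)$ means $f_1(x)$. Theorem. If $G$ is strongly-observable and non-revealing and the adversary is oblivious with switching costs, then the expected regret of any player strategy is bounded below by $\widetilde\Omega(T^{2/3})$ in the worst case over the adversary's losses. That is, there are absolute constants $c>0$ and $p,T_0\in\mathbb N$ such that for every such $G$, every $T\ge T_0$ and every randomized player strategy there are $\ell_1,\dots,\ell_T:V\to[0,1]$ for which $$\mathbb E[R_T]\ \ge\ c\,\frac{T^{2/3}}{(\log T)^p}.$$ -/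

import Mathlib

open MeasureTheory

namespace FeedbackGame

/-- The in-neighbourhood `{w | (w, v) ∈ E}`. A feedback graph is a directed graph in which
self-loops are allowed; an edge `(w, v)` means that playing `w` reveals the loss of `v`. -/
def inNbhd {V : Type*} (G : Digraph V) (v : V) : Set V := {w | G.Adj w v}

/-- Every vertex has a self-loop, or is observed by all the other vertices. -/
def StronglyObservable {V : Type*} (G : Digraph V) : Prop :=
  ∀ v : V, {v} ⊆ inNbhd G v ∨ Set.univ \ {v} ⊆ inNbhd G v

/-- Any two vertices have a common in-neighbour. -/
def Revealing {V : Type*} (G : Digraph V) : Prop :=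
  ∀ u v : V, (inNbhd G u ∩ inNbhd G v).Nonempty

/-- A (possibly adaptive) adversary: the loss of round `t` (rounds are counted from `0`) is a
function of the player's actions in the rounds `0, …, t`. -/
abbrev LossSeq (V : Type*) := (t : ℕ) → (Fin (t + 1) → V) → ℝ

open Classical in
/-- The oblivious adversary with switching costs that is obtained from the losses `ℓ`. -/
noncomputable def switchingLoss {V : Type*} (ℓ : ℕ → V → ℝ) : LossSeq V
  | 0, x => ℓ 0 (x 0)
  | t + 1, x => ℓ (t + 1) (x (Fin.last (t + 1))) +
      if x (Fin.last (t + 1)) ≠ x (Fin.last t).castSucc then 1 else 0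

open Classical in
/-- What the player sees when he plays `x` after the actions `past`: the vector whose `v`-th entry
is the loss that `v` would incur in this round if `v` is an out-neighbour of `x`, and `-1`
(not a value of a loss) if the loss of `v` is not observed. -/
noncomputable def feedback {V : Type*} (G : Digraph V) (f : LossSeq V) {t : ℕ}
    (past : Fin t → V) (x : V) : V → ℝ :=
  fun v => if G.Adj x v then f t (Fin.snoc (α := fun _ => V) past v) else -1

/-- A randomized player strategy with internal randomness `ω : Ω`: the action of round `t` is a
measurable function of `ω` and of the actions and feedback vectors of the rounds before `t`. -/
structure Strategy (V Ω : Type*) [MeasurableSpace V] [MeasurableSpace Ω] where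
  act : (t : ℕ) → Ω → (Fin t → V × (V → ℝ)) → V
  measurable_act : ∀ t : ℕ,
    Measurable fun p : Ω × (Fin t → V × (V → ℝ)) => act t p.1 p.2

/-- The actions and feedback vectors of the rounds before `t`. -/
noncomputable def history {V Ω : Type*} [MeasurableSpace V] [MeasurableSpace Ω]
    (G : Digraph V) (f : LossSeq V) (A : Strategy V Ω) (ω : Ω) :
    (t : ℕ) → Fin t → V × (V → ℝ)
  | 0 => Fin.elim0
  | t + 1 =>
      Fin.snoc (α := fun _ => V × (V → ℝ)) (history G f A ω t)
        (A.act t ω (history G f A ω t),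
          feedback G f (fun i => (history G f A ω t i).1) (A.act t ω (history G f A ω t)))

/-- The action that the strategy `A` plays in round `t`. -/
noncomputable def action {V Ω : Type*} [MeasurableSpace V] [MeasurableSpace Ω]
    (G : Digraph V) (f : LossSeq V) (A : Strategy V Ω) (ω : Ω) (t : ℕ) : V :=
  A.act t ω (history G f A ω t)

/-- The policy regret after `T` rounds of the actions `X` against the adversary `f`. -/
noncomputable def policyRegret {V : Type*} (f : LossSeq V) (T : ℕ) (X : ℕ → V) : ℝ :=
  ∑ t ∈ Finset.range T, f t (fun i => X i) - ⨅ x : V, ∑ t ∈ Finset.range T, f t (fun _ => x)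

/-- The expected policy regret of the strategy `A`, whose randomness has the law `P`. -/
noncomputable def expectedRegret {V Ω : Type*} [MeasurableSpace V] [MeasurableSpace Ω]
    (G : Digraph V) (f : LossSeq V) (T : ℕ) (A : Strategy V Ω) (P : Measure Ω) : ℝ :=
  ∫ ω, policyRegret f T (action G f A ω) ∂P

end FeedbackGame

namespace FeedbackGame

/-! ### Finite noise sequences and predictable shifts -/

/-! Two vertices `u ≠ v` are never observed in the same round. Give `u` a random base loss, give `v`
the base loss plus or minus `ε`, and give every other vertex loss `1`. If the base is lowered by
`2ε` exactly in the rounds where `v` is observed, the player sees the same data in both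
environments, hence plays the same actions (`le_average_regret`). These common actions either switch
`m` times or miss the best vertex in half of the rounds in one environment, so one of the two
regrets is at least `min m (εT/2)`.

It remains to make the change of base statistically invisible. The base is a walk on a dyadic tree
of depth `L ≈ log₂ T`. Its values stay within `L` steps of the start, and a change of the offset is
felt by at most `L` steps (`card_dyadic_increments_le`). With fewer than `m` switches the offset
changes at most `m + 1` times, so at most `(m + 1) * L` noise coordinates move, each by at most one
unit. The noise has law `g ^ 2` on `[-N, N]`, with unit-shift affinity `1 - O(1/N²)`
(`exists_smooth_profile`). The shift is predictable, so affinities multiply (`pow_le_affinity`), and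
the two laws overlap by a constant when `(m + 1) * L ≲ N²` (`two_point_bound`).

Losses in `[0,1]` require `ε ≲ 1/(NL)`. Taking `N ≈ T^(1/3)` makes both `m` and `εT` of order
`T^(2/3) / log T`. The noise has finite support, so everything is a finite weighted sum for each
value of the player's randomness. -/

open Classical in
/-- The integer sequences that vanish from index `n` on and are bounded by `N`. -/
noncomputable def noiseBox (N : ℕ) : ℕ → Finset (ℕ → ℤ)
  | 0 => {0}
  | n + 1 => (noiseBox N n ×ˢ Finset.Icc (-(N : ℤ)) N).image fun q => Function.update q.1 n q.2

theorem mem_noiseBox {N n : ℕ} {ξ : ℕ → ℤ} :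
    ξ ∈ noiseBox N n ↔ (∀ i < n, ξ i ∈ Finset.Icc (-(N : ℤ)) N) ∧ ∀ i, n ≤ i → ξ i = 0 := by
  classical
  induction n generalizing ξ with
  | zero => simp [noiseBox, funext_iff]
  | succ n ih =>
    simp only [noiseBox, Finset.mem_image, Finset.mem_product, Prod.exists]
    constructor
    · rintro ⟨η, k, ⟨hη, hk⟩, rfl⟩
      rw [ih] at hη
      refine ⟨fun i hi => ?_, fun i hi => ?_⟩
      · rcases eq_or_ne i n with rfl | h
        · simpa using hk
        · rw [Function.update_of_ne h]
          exact hη.1 i (by omega)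
      · rw [Function.update_of_ne (by omega)]
        exact hη.2 i (by omega)
    · rintro ⟨h1, h2⟩
      refine ⟨Function.update ξ n 0, ξ n, ⟨ih.2 ⟨fun i hi => ?_, fun i hi => ?_⟩, h1 n (by omega)⟩,
        by simp⟩
      · rw [Function.update_of_ne (by omega)]
        exact h1 i (by omega)
      · rcases eq_or_ne i n with rfl | h
        · simp
        · rw [Function.update_of_ne h]
          exact h2 i (by omega)

theorem sum_noiseBox_succ (N n : ℕ) (F : (ℕ → ℤ) → ℝ) :
    ∑ ξ ∈ noiseBox N (n + 1), F ξ =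
      ∑ ξ ∈ noiseBox N n, ∑ k ∈ Finset.Icc (-(N : ℤ)) N, F (Function.update ξ n k) := by
  classical
  rw [noiseBox, Finset.sum_image, Finset.sum_product]
  rintro ⟨ξ, k⟩ hξ ⟨η, l⟩ hη h
  simp only [Finset.coe_product, Set.mem_prod, Finset.mem_coe, mem_noiseBox] at hξ hη
  have hv : ∀ i, Function.update ξ n k i = Function.update η n l i := fun i => congrFun h i
  refine Prod.ext (funext fun i => ?_) (by simpa using hv n)
  rcases eq_or_ne i n with rfl | hi
  · exact (hξ.1.2 _ le_rfl).trans (hη.1.2 _ le_rfl).symm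
  · simpa [Function.update_of_ne hi] using hv i

/-- `s t ξ` depends only on the coordinates of `ξ` before `t`. -/
def Predictable {α : Type*} (s : ℕ → (ℕ → ℤ) → α) : Prop :=
  ∀ t ξ η, (∀ i < t, ξ i = η i) → s t ξ = s t η

theorem Predictable.update {α : Type*} {s : ℕ → (ℕ → ℤ) → α} (hs : Predictable s) {t n : ℕ}
    (h : t ≤ n) (ξ : ℕ → ℤ) (k : ℤ) : s t (Function.update ξ n k) = s t ξ :=
  hs t _ _ fun _ hi => Function.update_of_ne (by omega) _ _

/-- The coordinates are recovered from left to right. Injectivity lets the shift act as a change of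
variables on a discrete law without a Jacobian. -/
theorem Predictable.shift_injective {s : ℕ → (ℕ → ℤ) → ℤ} (hs : Predictable s) :
    Function.Injective fun ξ : ℕ → ℤ => fun t => ξ t + s t ξ := by
  intro ξ η h
  funext t
  induction t using Nat.strong_induction_on with
  | _ t ih =>
    have h1 : ξ t + s t ξ = η t + s t η := congrFun h t
    rw [hs t ξ η ih] at h1
    omega

theorem sum_noiseBox_prod (N n : ℕ) (p : ℤ → ℝ) (hp : ∑ k ∈ Finset.Icc (-(N : ℤ)) N, p k = 1) :
    ∑ ξ ∈ noiseBox N n, ∏ t ∈ Finset.range n, p (ξ t) = 1 := by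
  induction n with
  | zero => simp [noiseBox]
  | succ n ih =>
    rw [sum_noiseBox_succ, ← ih]
    refine Finset.sum_congr rfl fun ξ _ => ?_
    have : ∀ k, ∏ t ∈ Finset.range (n + 1), p (Function.update ξ n k t) =
        (∏ t ∈ Finset.range n, p (ξ t)) * p k := fun k => by
      rw [Finset.prod_range_succ, Function.update_self]
      congr 1
      refine Finset.prod_congr rfl fun t ht => ?_
      rw [Function.update_of_ne (by simp at ht; omega)]
    simp only [this, ← Finset.mul_sum, hp, mul_one]

/-- Hellinger affinity of a product law and its image under a predictable shift that moves at most
`B` coordinates. -/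
theorem pow_le_affinity {N n B : ℕ} {g : ℤ → ℝ} {r : ℝ} {s : ℕ → (ℕ → ℤ) → ℤ}
    (hg : ∀ k, 0 ≤ g k) (h1 : ∑ k ∈ Finset.Icc (-(N : ℤ)) N, g k ^ 2 = 1) (hr0 : 0 ≤ r)
    (hr1 : r ≤ 1)
    (hr : ∀ σ : ℤ, |σ| = 1 → r ≤ ∑ k ∈ Finset.Icc (-(N : ℤ)) N, g k * g (k + σ))
    (hs : Predictable s) (hs1 : ∀ t ξ, |s t ξ| ≤ 1)
    (hB : ∀ ξ, ((Finset.range n).filter fun t => s t ξ ≠ 0).card ≤ B) :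
    r ^ B ≤ ∑ ξ ∈ noiseBox N n, ∏ t ∈ Finset.range n, g (ξ t) * g (ξ t + s t ξ) := by
  -- The factor `r ^ (unused budget)` closes the induction: given the past, the shift of coordinate
  -- `j` is fixed, so summing over that coordinate gives `1` if it does not move and at least one
  -- `r` from the budget if it does.
  have key : ∀ j ≤ n, r ^ B ≤ ∑ ξ ∈ noiseBox N j,
      (∏ t ∈ Finset.range j, g (ξ t) * g (ξ t + s t ξ)) *
        r ^ (B - ((Finset.range j).filter fun t => s t ξ ≠ 0).card) := by
    intro j
    induction j with
    | zero => simp [noiseBox]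
    | succ j ih =>
      intro hj
      refine (ih (by omega)).trans ?_
      rw [sum_noiseBox_succ]
      refine Finset.sum_le_sum fun ξ _ => ?_
      have hprod : ∀ k, ∏ t ∈ Finset.range (j + 1), g (Function.update ξ j k t) *
          g (Function.update ξ j k t + s t (Function.update ξ j k)) =
          (∏ t ∈ Finset.range j, g (ξ t) * g (ξ t + s t ξ)) * (g k * g (k + s j ξ)) := fun k => by
        rw [Finset.prod_range_succ, Function.update_self, hs.update le_rfl]
        congr 1
        refine Finset.prod_congr rfl fun t ht => ?_
        rw [Finset.mem_range] at ht
        rw [Function.update_of_ne (by omega), hs.update ht.le]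
      have hcard : ∀ k, ((Finset.range (j + 1)).filter
          fun t => s t (Function.update ξ j k) ≠ 0).card =
          ((Finset.range (j + 1)).filter fun t => s t ξ ≠ 0).card := fun k => by
        congr 1
        refine Finset.filter_congr fun t ht => ?_
        rw [Finset.mem_range] at ht
        rw [hs.update (by omega)]
      simp only [hprod, hcard]
      rw [← Finset.sum_mul, ← Finset.mul_sum, mul_assoc]
      refine mul_le_mul_of_nonneg_left ?_
        (Finset.prod_nonneg fun t _ => mul_nonneg (hg _) (hg _))
      rw [Finset.range_add_one, Finset.filter_insert]
      split_ifs with h0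
      · have hc := (Finset.card_le_card (Finset.filter_subset_filter (fun t => s t ξ ≠ 0)
          (Finset.range_subset_range.2 hj))).trans (hB ξ)
        rw [Finset.range_add_one, Finset.filter_insert, if_pos h0,
          Finset.card_insert_of_notMem (by simp)] at hc
        rw [Finset.card_insert_of_notMem (by simp)]
        have habs : |s j ξ| = 1 := le_antisymm (hs1 j ξ) (Int.one_le_abs h0)
        calc _ = r * r ^ (B - (((Finset.range j).filter fun t => s t ξ ≠ 0).card + 1)) := by
              rw [← pow_succ']
              congr 1
              omega
          _ ≤ _ := mul_le_mul_of_nonneg_right (hr _ habs) (pow_nonneg hr0 _)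
      · rw [not_not] at h0
        simp only [h0, add_zero, ← sq, h1, one_mul, le_refl]
  refine (key n le_rfl).trans (Finset.sum_le_sum fun ξ _ => ?_)
  exact mul_le_of_le_one_right (Finset.prod_nonneg fun t _ => mul_nonneg (hg _) (hg _))
    (pow_le_one₀ hr0 hr1)

/-- Cauchy–Schwarz after reordering each product as root of the minimum times root of the maximum.
It turns affinity into overlap. -/
theorem sq_sum_mul_le {ι : Type*} (S : Finset ι) (a b : ι → ℝ)
    (ha : ∑ i ∈ S, a i ^ 2 ≤ 1) (hb : ∑ i ∈ S, b i ^ 2 ≤ 1) :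
    (∑ i ∈ S, a i * b i) ^ 2 ≤ 2 * ∑ i ∈ S, min (a i ^ 2) (b i ^ 2) := by
  have hm : ∀ i, ∃ x y : ℝ, a i * b i = x * y ∧ x ^ 2 = min (a i ^ 2) (b i ^ 2) ∧
      y ^ 2 = max (a i ^ 2) (b i ^ 2) := fun i => by
    rcases le_total (a i ^ 2) (b i ^ 2) with h | h
    · exact ⟨a i, b i, rfl, (min_eq_left h).symm, (max_eq_right h).symm⟩
    · exact ⟨b i, a i, mul_comm _ _, (min_eq_right h).symm, (max_eq_left h).symm⟩
  choose x y hxy hx hy using hm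
  have hmax : ∑ i ∈ S, y i ^ 2 ≤ 2 := by
    calc ∑ i ∈ S, y i ^ 2 ≤ ∑ i ∈ S, (a i ^ 2 + b i ^ 2) := Finset.sum_le_sum fun i _ => by
          rw [hy]
          exact max_le (by nlinarith [sq_nonneg (b i)]) (by nlinarith [sq_nonneg (a i)])
      _ ≤ 2 := by rw [Finset.sum_add_distrib]; linarith
  have h0 : 0 ≤ ∑ i ∈ S, x i ^ 2 := Finset.sum_nonneg fun i _ => sq_nonneg _
  calc (∑ i ∈ S, a i * b i) ^ 2 = (∑ i ∈ S, x i * y i) ^ 2 := by simp only [hxy]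
    _ ≤ (∑ i ∈ S, x i ^ 2) * ∑ i ∈ S, y i ^ 2 := Finset.sum_mul_sq_le_sq_mul_sq _ _ _
    _ ≤ (∑ i ∈ S, x i ^ 2) * 2 := mul_le_mul_of_nonneg_left hmax h0
    _ = _ := by simp only [hx, mul_comm]

/-- Two-point method: `RA` at the shifted noise or `RB` at the noise is at least `K`. -/
theorem two_point_bound {N n B : ℕ} {g : ℤ → ℝ} {h K : ℝ} {s : ℕ → (ℕ → ℤ) → ℤ}
    {RA RB : (ℕ → ℤ) → ℝ}
    (hg : ∀ k, 0 ≤ g k) (hsupp : ∀ k, g k ≠ 0 → k ∈ Finset.Icc (-(N : ℤ)) N)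
    (h1 : ∑ k ∈ Finset.Icc (-(N : ℤ)) N, g k ^ 2 = 1) (hh0 : 0 ≤ h)
    (hh1 : h ≤ 1) (hr : ∀ σ : ℤ, |σ| = 1 → 1 - h ≤ ∑ k ∈ Finset.Icc (-(N : ℤ)) N, g k * g (k + σ))
    (hs : Predictable s) (hs1 : ∀ t ξ, |s t ξ| ≤ 1) (hs0 : ∀ t ξ, n ≤ t → s t ξ = 0)
    (hB : ∀ ξ, ((Finset.range n).filter fun t => s t ξ ≠ 0).card ≤ B) (hBh : B * h ≤ 1 / 2)
    (hK : 0 ≤ K) (hA : ∀ ξ ∈ noiseBox N n, 0 ≤ RA ξ) (hRB : ∀ ξ ∈ noiseBox N n, 0 ≤ RB ξ)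
    (hAB : ∀ ξ ∈ noiseBox N n, (fun t => ξ t + s t ξ) ∈ noiseBox N n →
      K ≤ RB ξ ∨ K ≤ RA fun t => ξ t + s t ξ) :
    K / 8 ≤ ∑ ξ ∈ noiseBox N n, (∏ t ∈ Finset.range n, g (ξ t) ^ 2) * (RA ξ + RB ξ) := by
  classical
  set ψ : (ℕ → ℤ) → ℕ → ℤ := fun ξ t => ξ t + s t ξ with hψ
  set a : (ℕ → ℤ) → ℝ := fun ξ => ∏ t ∈ Finset.range n, g (ξ t) with ha
  have hw : ∀ ξ, ∏ t ∈ Finset.range n, g (ξ t) ^ 2 = a ξ ^ 2 := fun ξ => Finset.prod_pow _ _ _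
  have hψbox : ∀ ξ ∈ noiseBox N n, a (ψ ξ) ≠ 0 → ψ ξ ∈ noiseBox N n := fun ξ hξ h0 => by
    rw [mem_noiseBox] at hξ ⊢
    refine ⟨fun i hi => hsupp _ ?_, fun i hi => ?_⟩
    · exact Finset.prod_ne_zero_iff.1 h0 i (Finset.mem_range.2 hi)
    · simp only [hψ, hs0 i ξ hi, hξ.2 i hi, add_zero]
  -- Change of variables along the injective `ψ`; points sent outside the box carry weight `a (ψ ξ)
  -- = 0`.
  have hpull : ∀ F : (ℕ → ℤ) → ℝ, (∀ ξ ∈ noiseBox N n, 0 ≤ F ξ) →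
      ∑ ξ ∈ noiseBox N n, a (ψ ξ) ^ 2 * F (ψ ξ) ≤ ∑ ξ ∈ noiseBox N n, a ξ ^ 2 * F ξ := by
    intro F hF
    rw [← Finset.sum_filter_of_ne (p := fun ξ => ψ ξ ∈ noiseBox N n)]
    · rw [← Finset.sum_image (s := (noiseBox N n).filter fun ξ => ψ ξ ∈ noiseBox N n) (g := ψ)
        (f := fun ξ => a ξ ^ 2 * F ξ) (fun ξ _ η _ h => hs.shift_injective h)]
      refine Finset.sum_le_sum_of_subset_of_nonneg (fun η hη => ?_)
        fun ξ hξ _ => mul_nonneg (sq_nonneg _) (hF ξ hξ)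
      obtain ⟨ξ, hξ, rfl⟩ := Finset.mem_image.1 hη
      exact (Finset.mem_filter.1 hξ).2
    · intro ξ hξ h0
      refine hψbox ξ hξ fun h => h0 ?_
      rw [h]
      ring
  have hmass : ∑ ξ ∈ noiseBox N n, a ξ ^ 2 = 1 := by
    simp only [← hw]
    exact sum_noiseBox_prod N n (fun k => g k ^ 2) h1
  have hmass' : ∑ ξ ∈ noiseBox N n, a (ψ ξ) ^ 2 ≤ 1 := by
    have := hpull (fun _ => 1) fun _ _ => zero_le_one
    simpa only [mul_one, hmass] using this
  have haff : 1 / 2 ≤ ∑ ξ ∈ noiseBox N n, a ξ * a (ψ ξ) := by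
    have h2 := pow_le_affinity hg h1 (by linarith) (by linarith) hr hs hs1 hB
    -- Bernoulli: `(1 - h) ^ B ≥ 1 - B * h ≥ 1 / 2`. The overlap is then at least `(1 / 2)² / 2 = 1
    -- / 8`.
    have h3 := one_add_mul_le_pow (show (-2 : ℝ) ≤ -h by linarith) B
    simp only [Finset.prod_mul_distrib] at h2
    rw [← sub_eq_add_neg] at h3
    linarith
  have hmin := sq_sum_mul_le (noiseBox N n) a (fun ξ => a (ψ ξ)) hmass.le hmass'
  have hmin' : 1 / 8 ≤ ∑ ξ ∈ noiseBox N n, min (a ξ ^ 2) (a (ψ ξ) ^ 2) := by nlinarith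
  calc K / 8 ≤ ∑ ξ ∈ noiseBox N n, K * min (a ξ ^ 2) (a (ψ ξ) ^ 2) := by
        rw [← Finset.mul_sum]; nlinarith
    _ ≤ ∑ ξ ∈ noiseBox N n, (a (ψ ξ) ^ 2 * RA (ψ ξ) + a ξ ^ 2 * RB ξ) := by
        refine Finset.sum_le_sum fun ξ hξ => ?_
        have hRBξ := hRB ξ hξ
        by_cases h0 : a (ψ ξ) = 0
        · rw [h0]
          have : min (a ξ ^ 2) ((0 : ℝ) ^ 2) = 0 := by simp [sq_nonneg]
          rw [this]
          nlinarith [mul_nonneg (sq_nonneg (a ξ)) hRBξ]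
        · have hb := hψbox ξ hξ h0
          have hRAξ := hA _ hb
          have m1 := min_le_left (a ξ ^ 2) (a (ψ ξ) ^ 2)
          have m2 := min_le_right (a ξ ^ 2) (a (ψ ξ) ^ 2)
          rcases hAB ξ hξ hb with h | h
          · nlinarith [mul_nonneg (sq_nonneg (a (ψ ξ))) hRAξ,
              mul_le_mul_of_nonneg_left h (sq_nonneg (a ξ)), mul_le_mul_of_nonneg_left m1 hK]
          · nlinarith [mul_nonneg (sq_nonneg (a ξ)) hRBξ,
              mul_le_mul_of_nonneg_left h (sq_nonneg (a (ψ ξ))), mul_le_mul_of_nonneg_left m2 hK]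
    _ ≤ _ := by
        simp only [hw, mul_add]
        rw [Finset.sum_add_distrib, Finset.sum_add_distrib]
        exact add_le_add_left (hpull RA hA) _

/-- A unit vector on `[-N, N]` whose unit shifts have inner product at least `1 - 5 / N²`
with it. -/
theorem exists_smooth_profile {N : ℕ} (hN : 1 ≤ N) :
    ∃ g : ℤ → ℝ, (∀ k, 0 ≤ g k) ∧ (∀ k, g k ≠ 0 → k ∈ Finset.Icc (-(N : ℤ)) N) ∧
      ∑ k ∈ Finset.Icc (-(N : ℤ)) N, g k ^ 2 = 1 ∧
      ∀ σ : ℤ, |σ| = 1 →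
        1 - 5 / (N : ℝ) ^ 2 ≤ ∑ k ∈ Finset.Icc (-(N : ℤ)) N, g k * g (k + σ) := by
  have hN' : (1 : ℝ) ≤ N := by exact_mod_cast hN
  set γ : ℤ → ℝ := fun k => max 0 ((N : ℝ) - |(k : ℝ)|) with hγ
  set Z : ℝ := ∑ k ∈ Finset.Icc (-(N : ℤ)) N, γ k ^ 2 with hZ
  have hγ0 : ∀ k, 0 ≤ γ k := fun k => le_max_left _ _
  have hγs : ∀ k, γ k ≠ 0 → |k| < N := fun k hk => by
    by_contra h
    refine hk (max_eq_left ?_)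
    have : ((N : ℤ) : ℝ) ≤ ((|k| : ℤ) : ℝ) := by exact_mod_cast not_lt.1 h
    push_cast at this
    linarith
  have hZN : (N : ℝ) ^ 3 / 3 ≤ Z := by
    have h1 : ∀ n : ℕ, (n : ℝ) ^ 3 / 3 ≤ ∑ j ∈ Finset.range n, ((j : ℝ) + 1) ^ 2 := fun n => by
      induction n with
      | zero => simp
      | succ n ih =>
        rw [Finset.sum_range_succ]
        push_cast
        have : (0 : ℝ) ≤ n := n.cast_nonneg
        nlinarith
    refine (h1 N).trans ?_
    rw [← Finset.sum_range_reflect]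
    have h2 : ∀ j ∈ Finset.range N, (((N - 1 - j : ℕ) : ℝ) + 1) ^ 2 = γ (j : ℤ) ^ 2 :=
      fun j hj => by
        rw [Finset.mem_range] at hj
        have h3 : N - 1 - j + 1 + j = N := by omega
        have h4 : ((N - 1 - j : ℕ) : ℝ) + 1 + j = N := by exact_mod_cast h3
        have h5 : (0 : ℝ) ≤ ((N - 1 - j : ℕ) : ℝ) := Nat.cast_nonneg _
        simp only [hγ, Int.cast_natCast, Nat.abs_cast]
        rw [max_eq_right (by linarith)]
        congr 1
        linarith
    rw [Finset.sum_congr rfl h2, ← Finset.sum_image (g := fun j : ℕ => (j : ℤ))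
      (f := fun k => γ k ^ 2) (fun i _ j _ h => by simpa using h)]
    refine Finset.sum_le_sum_of_subset_of_nonneg (fun k hk => ?_) fun _ _ _ => sq_nonneg _
    obtain ⟨j, hj, rfl⟩ := Finset.mem_image.1 hk
    rw [Finset.mem_range] at hj
    rw [Finset.mem_Icc]
    omega
  have hZ0 : 0 < Z := lt_of_lt_of_le (by positivity) hZN
  -- The tent `γ` is 1-Lipschitz, so a unit shift costs at most `1 / 2` at each of `2N + 1 ≤ 3N`
  -- points. Relative to `Z ≥ N³ / 3` this is `9 / (2N²) ≤ 5 / N²`.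
  have hcorr : ∀ σ : ℤ, |σ| = 1 →
      Z - 3 * N / 2 ≤ ∑ k ∈ Finset.Icc (-(N : ℤ)) N, γ k * γ (k + σ) := by
    intro σ hσ
    have hshift : Z ≤ ∑ k ∈ Finset.Icc (-(N : ℤ)) N, γ (k + σ) ^ 2 := by
      rw [← Finset.sum_image (g := fun k : ℤ => k + σ) (f := fun k => γ k ^ 2)
        (fun i _ j _ h => by simpa using h), hZ,
        ← Finset.sum_filter_of_ne (p := fun k : ℤ => |k| < N)]
      · refine Finset.sum_le_sum_of_subset_of_nonneg (fun k hk => ?_) fun _ _ _ => sq_nonneg _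
        have hk' := (Finset.mem_filter.1 hk).2
        refine Finset.mem_image.2 ⟨k - σ, ?_, by ring⟩
        rw [Finset.mem_Icc]
        rw [abs_lt] at hk'
        have := abs_le.1 hσ.le
        omega
      · intro k _ h
        exact hγs k fun h0 => h (by simp [h0])
    have hdiff : ∀ k, (γ k - γ (k + σ)) ^ 2 ≤ 1 := fun k => by
      rw [sq_le_one_iff_abs_le_one]
      have h := abs_max_sub_max_le_abs ((N : ℝ) - |(k : ℝ)|) (N - |((k + σ : ℤ) : ℝ)|) 0
      rw [max_comm _ (0 : ℝ), max_comm _ (0 : ℝ)] at h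
      refine h.trans ?_
      have h1 : ((N : ℝ) - |(k : ℝ)|) - (N - |((k + σ : ℤ) : ℝ)|) =
          |((k + σ : ℤ) : ℝ)| - |(k : ℝ)| := by ring
      rw [h1]
      refine (abs_abs_sub_abs_le_abs_sub _ _).trans ?_
      push_cast
      rw [add_sub_cancel_left]
      exact_mod_cast hσ.le
    have hsum : ∑ k ∈ Finset.Icc (-(N : ℤ)) N, (γ k ^ 2 + γ (k + σ) ^ 2 - 1) ≤
        ∑ k ∈ Finset.Icc (-(N : ℤ)) N, 2 * (γ k * γ (k + σ)) :=
      Finset.sum_le_sum fun k _ => by nlinarith [hdiff k]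
    rw [← Finset.mul_sum, Finset.sum_sub_distrib, Finset.sum_add_distrib] at hsum
    simp only [Finset.sum_const, Int.card_Icc, nsmul_eq_mul, mul_one] at hsum
    have hc : (((N : ℤ) + 1 - -(N : ℤ)).toNat : ℝ) = 2 * N + 1 := by
      have : ((N : ℤ) + 1 - -(N : ℤ)).toNat = 2 * N + 1 := by omega
      rw [this]
      push_cast
      ring
    rw [hc] at hsum
    linarith
  have hsq : √Z ^ 2 = Z := Real.sq_sqrt hZ0.le
  refine ⟨fun k => γ k / √Z, fun k => div_nonneg (hγ0 k) (Real.sqrt_nonneg _), fun k hk => ?_,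
    ?_, fun σ hσ => ?_⟩
  · have := abs_lt.1 (hγs k fun h => hk (by simp [h]))
    rw [Finset.mem_Icc]
    omega
  · simp only [div_pow, hsq]
    rw [← Finset.sum_div, div_self hZ0.ne']
  · have : ∀ k, γ k / √Z * (γ (k + σ) / √Z) = γ k * γ (k + σ) / Z := fun k => by
      rw [div_mul_div_comm, ← sq, hsq]
    simp only [this]
    rw [← Finset.sum_div, le_div_iff₀ hZ0]
    refine le_trans ?_ (hcorr σ hσ)
    rw [sub_mul, one_mul]
    have : 3 * (N : ℝ) / 2 ≤ 5 / (N : ℝ) ^ 2 * Z := by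
      rw [div_mul_eq_mul_div, le_div_iff₀ (by positivity)]
      nlinarith [pow_pos (lt_of_lt_of_le one_pos hN') 3]
    linarith

/-! ### The multi-scale random walk -/

/-- Removes the lowest binary digit `1` of `n`. -/
def dyadicParent (n : ℕ) : ℕ := n - 2 ^ padicValNat 2 n

theorem dyadicParent_succ_le (n : ℕ) : dyadicParent (n + 1) ≤ n := by
  have := Nat.one_le_two_pow (n := padicValNat 2 (n + 1))
  unfold dyadicParent
  omega

/-- The walk whose step into time `n + 1` starts from the dyadic parent of `n + 1`. -/
def dyadicWalk (ξ : ℕ → ℤ) : ℕ → ℤ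
  | 0 => 0
  | n + 1 => dyadicWalk ξ (dyadicParent (n + 1)) + ξ n
termination_by n => n
decreasing_by exact Nat.lt_succ_of_le (dyadicParent_succ_le n)

theorem dyadicWalk_succ (ξ : ℕ → ℤ) (n : ℕ) :
    dyadicWalk ξ (n + 1) = dyadicWalk ξ (dyadicParent (n + 1)) + ξ n := by
  rw [dyadicWalk]

theorem dyadicWalk_congr {ξ η : ℕ → ℤ} {n : ℕ} (h : ∀ i < n, ξ i = η i) :
    dyadicWalk ξ n = dyadicWalk η n := by
  induction n using Nat.strong_induction_on with
  | _ n ih =>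
    cases n with
    | zero => rw [dyadicWalk, dyadicWalk]
    | succ n =>
      have hp := dyadicParent_succ_le n
      rw [dyadicWalk_succ, dyadicWalk_succ, h n (by omega),
        ih _ (by omega) fun i hi => h i (by omega)]

/-- A shift of the steps by the increments of `d` shifts the walk by `d`. -/
theorem dyadicWalk_shift {ξ d : ℕ → ℤ} (h0 : d 0 = 0) {n : ℕ} {η : ℕ → ℤ}
    (hη : ∀ t < n, η t = ξ t + (d (dyadicParent (t + 1)) - d (t + 1))) :
    dyadicWalk η n = dyadicWalk ξ n - d n := by
  induction n using Nat.strong_induction_on with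
  | _ n ih =>
    cases n with
    | zero => simp [dyadicWalk, h0]
    | succ n =>
      have hp := dyadicParent_succ_le n
      rw [dyadicWalk_succ, dyadicWalk_succ, hη n (by omega),
        ih _ (by omega) fun i hi => hη i (by omega)]
      ring

theorem dyadicParent_two_pow_mul (j m : ℕ) :
    dyadicParent (2 ^ j * (2 * m + 1)) = 2 ^ (j + 1) * m := by
  have hv : padicValNat 2 (2 ^ j * (2 * m + 1)) = j := by
    rw [padicValNat.mul (by positivity) (by omega), padicValNat.prime_pow,
      padicValNat.eq_zero_of_not_dvd (by omega), add_zero]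
  rw [dyadicParent, hv, pow_succ, mul_add, mul_one, Nat.add_sub_cancel]
  ring

/-- Passing to the parent strictly raises the 2-adic valuation, which stays below `L` until `0` is
reached; hence at most `L` steps. The induction carries a lower bound `j` on the valuation. -/
theorem abs_dyadicWalk_le {ξ : ℕ → ℤ} {N : ℤ} {T : ℕ} (hξ : ∀ t < T, |ξ t| ≤ N) (hN : 0 ≤ N)
    {L : ℕ} (n : ℕ) (hn : n ≤ T) (hL : n < 2 ^ L) : |dyadicWalk ξ n| ≤ N * L := by
  have key : ∀ n ≤ T, n < 2 ^ L → ∀ j ≤ L, 2 ^ j ∣ n → |dyadicWalk ξ n| ≤ N * ((L - j : ℕ) : ℤ) := by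
    intro n
    induction n using Nat.strong_induction_on with
    | _ n ih =>
      intro hn hL j hj hdvd
      rcases Nat.eq_zero_or_pos n with rfl | hpos
      · rw [dyadicWalk, abs_zero]
        positivity
      obtain ⟨i, q, ⟨m, rfl⟩, hi⟩ := Nat.exists_eq_two_pow_mul_odd hpos.ne'
      have hji : j ≤ i := by
        by_contra h
        rw [hi, show j = i + (j - i) by omega, pow_add] at hdvd
        have h2 := Nat.dvd_of_mul_dvd_mul_left (by positivity) hdvd
        have h3 : 2 ∣ 2 * m + 1 := (dvd_pow_self 2 (by omega)).trans h2
        omega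
      have hiL : i < L := by
        by_contra h
        have h1 : 2 ^ L ≤ 2 ^ i := Nat.pow_le_pow_right (by norm_num) (by omega)
        have h2 : 2 ^ i * 1 ≤ 2 ^ i * (2 * m + 1) := Nat.mul_le_mul_left _ (by omega)
        omega
      obtain ⟨n, rfl⟩ : ∃ k, n = k + 1 := ⟨n - 1, by omega⟩
      have hp := dyadicParent_succ_le n
      rw [dyadicWalk_succ]
      have h1 := ih (dyadicParent (n + 1)) (by omega) (by omega) (by omega) (i + 1) hiL
        (by rw [hi, dyadicParent_two_pow_mul]; exact dvd_mul_right _ _)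
      have h2 := hξ n (by omega)
      calc _ ≤ N * ((L - (i + 1) : ℕ) : ℤ) + N := (abs_add_le _ _).trans (add_le_add h1 h2)
        _ = N * ((L - i : ℕ) : ℤ) := by
          rw [show L - i = L - (i + 1) + 1 by omega]
          push_cast
          ring
        _ ≤ _ := mul_le_mul_of_nonneg_left (by omega) hN
  simpa using key n hn hL 0 (Nat.zero_le _) (by simp)

/-- At most `L` steps of the walk before time `2 ^ L` pass over a given time. -/
theorem card_dyadic_cut_le {T L : ℕ} (hT : T < 2 ^ L) (σ : ℕ) :
    ((Finset.range T).filter fun t => dyadicParent (t + 1) ≤ σ ∧ σ ≤ t).card ≤ L := by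
  have hsucc : ∀ t, ∃ i m, t + 1 = 2 ^ i * (2 * m + 1) := fun t => by
    obtain ⟨i, q, ⟨m, rfl⟩, hi⟩ := Nat.exists_eq_two_pow_mul_odd (Nat.succ_ne_zero t)
    exact ⟨i, m, hi⟩
  -- `i t` is the scale of the step into `t + 1`. Steps of equal scale cover disjoint time
  -- intervals, so each of the `L` scales crosses `σ` at most once.
  choose i m him using hsucc
  rw [← Finset.card_range L]
  refine Finset.card_le_card_of_injOn i (fun t ht => ?_) fun t ht t' ht' h => ?_
  · simp only [Finset.coe_filter, Finset.mem_range, Set.mem_ofPred_eq] at ht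
    simp only [Finset.coe_range, Set.mem_Iio]
    by_contra hc
    have h1 : 2 ^ L ≤ 2 ^ i t := Nat.pow_le_pow_right (by norm_num) (by omega)
    have h2 : 2 ^ i t * 1 ≤ 2 ^ i t * (2 * m t + 1) := Nat.mul_le_mul_left _ (by omega)
    have := him t
    omega
  · simp only [Finset.coe_filter, Finset.mem_range, Set.mem_ofPred_eq] at ht ht'
    obtain ⟨-, h1, h2⟩ := ht
    obtain ⟨-, h1', h2'⟩ := ht'
    have e := him t
    have e' := him t'
    rw [← h] at e'
    rw [e, dyadicParent_two_pow_mul, pow_succ, mul_assoc] at h1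
    rw [e', dyadicParent_two_pow_mul, pow_succ, mul_assoc] at h1'
    have hpos : 0 < 2 ^ i t := by positivity
    have l1 : 2 ^ i t * (2 * m t) < 2 ^ i t * (2 * m t' + 1) := by omega
    have l2 : 2 ^ i t * (2 * m t') < 2 ^ i t * (2 * m t + 1) := by omega
    have l1' := Nat.lt_of_mul_lt_mul_left l1
    have l2' := Nat.lt_of_mul_lt_mul_left l2
    have : m t = m t' := by omega
    rw [this] at e
    omega

/-- If `d` changes at most `b` times then at most `b * L` steps of the walk see a change. -/
theorem card_dyadic_increments_le {T L b : ℕ} (hT : T < 2 ^ L) (d : ℕ → ℤ)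
    (hb : ((Finset.range T).filter fun τ => d (τ + 1) ≠ d τ).card ≤ b) :
    ((Finset.range T).filter fun t => d (dyadicParent (t + 1)) - d (t + 1) ≠ 0).card ≤ b * L := by
  classical
  have hsub : ((Finset.range T).filter fun t => d (dyadicParent (t + 1)) - d (t + 1) ≠ 0) ⊆
      ((Finset.range T).filter fun τ => d (τ + 1) ≠ d τ).biUnion fun σ =>
        (Finset.range T).filter fun t => dyadicParent (t + 1) ≤ σ ∧ σ ≤ t := by
    intro t ht
    rw [Finset.mem_filter, Finset.mem_range] at ht
    by_contra hc
    have hconst : ∀ j, dyadicParent (t + 1) + j ≤ t + 1 →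
        d (dyadicParent (t + 1) + j) = d (dyadicParent (t + 1)) := by
      intro j
      induction j with
      | zero => simp
      | succ j ih =>
        intro hj
        rw [← ih (by omega)]
        by_contra hne
        refine hc (Finset.mem_biUnion.2 ⟨dyadicParent (t + 1) + j, ?_, ?_⟩)
        · rw [Finset.mem_filter, Finset.mem_range]
          exact ⟨by omega, hne⟩
        · rw [Finset.mem_filter, Finset.mem_range]
          omega
    have hp := dyadicParent_succ_le t
    have := hconst (t + 1 - dyadicParent (t + 1)) (by omega)
    rw [show dyadicParent (t + 1) + (t + 1 - dyadicParent (t + 1)) = t + 1 by omega] at this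
    exact ht.2 (by rw [this, sub_self])
  calc _ ≤ _ := Finset.card_le_card hsub
    _ ≤ _ := Finset.card_biUnion_le_card_mul _ _ L fun σ _ => card_dyadic_cut_le hT σ
    _ ≤ b * L := Nat.mul_le_mul_right _ hb

/-! ### Regret and observations under switching costs -/

section Regret

variable {V : Type*}

open Classical in
/-- The number of switches in the rounds `1, …, n`. -/
noncomputable def switchCount (X : ℕ → V) (n : ℕ) : ℕ :=
  ((Finset.range n).filter fun r => X (r + 1) ≠ X r).card

theorem switchCount_succ_of_eq {X : ℕ → V} {n : ℕ} (h : X (n + 1) = X n) :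
    switchCount X (n + 1) = switchCount X n := by
  classical
  rw [switchCount, Finset.range_add_one, Finset.filter_insert, if_neg (by simpa using h),
    switchCount]

theorem switchCount_succ_of_ne {X : ℕ → V} {n : ℕ} (h : X (n + 1) ≠ X n) :
    switchCount X (n + 1) = switchCount X n + 1 := by
  classical
  rw [switchCount, Finset.range_add_one, Finset.filter_insert, if_pos h,
    Finset.card_insert_of_notMem (by simp), switchCount]

theorem switchCount_mono (X : ℕ → V) : Monotone (switchCount X) := fun _ _ h => by
  classical
  rw [switchCount, switchCount]
  exact Finset.card_le_card (Finset.filter_subset_filter _ (Finset.range_subset_range.2 h))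

theorem switchCount_congr {X Y : ℕ → V} {n : ℕ} (h : ∀ i ≤ n, X i = Y i) :
    switchCount X n = switchCount Y n := by
  classical
  rw [switchCount, switchCount]
  congr 1
  refine Finset.filter_congr fun r hr => ?_
  rw [Finset.mem_range] at hr
  rw [h _ hr, h _ hr.le]

theorem sum_switchingLoss (ℓ : ℕ → V → ℝ) (X : ℕ → V) (n : ℕ) :
    ∑ t ∈ Finset.range (n + 1), switchingLoss ℓ t (fun i => X i) =
      ∑ t ∈ Finset.range (n + 1), ℓ t (X t) + switchCount X n := by
  induction n with
  | zero => simp [switchingLoss, switchCount]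
  | succ n ih =>
    rw [Finset.sum_range_succ, ih, Finset.sum_range_succ _ (n + 1)]
    by_cases h : X (n + 1) = X n
    · rw [switchCount_succ_of_eq h]
      simp [switchingLoss, h]
      ring
    · rw [switchCount_succ_of_ne h]
      simp [switchingLoss, h]
      ring

open Classical in
-- The constant comparator `x₀` never pays for a switch.
theorem le_policyRegret [Finite V] {ℓ : ℕ → V → ℝ} {X : ℕ → V} {n : ℕ} {x₀ : V} {ε : ℝ}
    (h : ∀ t ≤ n, ∀ x ≠ x₀, ε ≤ ℓ t x - ℓ t x₀) :
    ε * ((Finset.range (n + 1)).filter fun t => X t ≠ x₀).card + switchCount X n ≤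
      policyRegret (switchingLoss ℓ) (n + 1) X := by
  have h1 : ⨅ x : V, ∑ t ∈ Finset.range (n + 1), switchingLoss ℓ t (fun _ => x) ≤
      ∑ t ∈ Finset.range (n + 1), ℓ t x₀ := by
    refine (ciInf_le (Set.finite_range _).bddBelow x₀).trans_eq ?_
    rw [sum_switchingLoss ℓ (fun _ => x₀)]
    simp [switchCount]
  have h2 : ε * ((Finset.range (n + 1)).filter fun t => X t ≠ x₀).card ≤
      ∑ t ∈ Finset.range (n + 1), (ℓ t (X t) - ℓ t x₀) := by
    rw [mul_comm, ← nsmul_eq_mul, ← Finset.sum_const, Finset.sum_filter]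
    refine Finset.sum_le_sum fun t ht => ?_
    rw [Finset.mem_range] at ht
    split_ifs with hx
    · exact h t (by omega) _ hx
    · rw [not_not] at hx
      simp [hx]
  rw [Finset.sum_sub_distrib] at h2
  rw [policyRegret, sum_switchingLoss]
  linarith

theorem switchingLoss_congr {ℓ ℓ' : ℕ → V → ℝ} {t : ℕ} {x : Fin (t + 1) → V}
    (h : ℓ t (x (Fin.last t)) = ℓ' t (x (Fin.last t))) :
    switchingLoss ℓ t x = switchingLoss ℓ' t x := by
  cases t with
  | zero => exact h
  | succ t => rw [switchingLoss, switchingLoss, h]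

end Regret

section Observations

variable {V Ω : Type*} [MeasurableSpace V] [MeasurableSpace Ω]

/-- The play is the same under losses that agree wherever they are observed. -/
theorem history_congr {G : Digraph V} {A : Strategy V Ω} {ω : Ω} {ℓ ℓ' : ℕ → V → ℝ} {t : ℕ}
    (h : ∀ r < t, ∀ y, G.Adj (action G (switchingLoss ℓ) A ω r) y → ℓ r y = ℓ' r y) :
    history G (switchingLoss ℓ) A ω t = history G (switchingLoss ℓ') A ω t := by
  induction t with
  | zero => rfl
  | succ t ih =>
    have ih' := ih fun r hr => h r (by omega)
    rw [history, history, ← ih']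
    congr 2
    funext y
    unfold feedback
    split_ifs with hy
    · refine switchingLoss_congr ?_
      rw [Fin.snoc_last]
      exact h t (by omega) y hy
    · rfl

theorem action_congr {G : Digraph V} {A : Strategy V Ω} {ω : Ω} {ℓ ℓ' : ℕ → V → ℝ} {t : ℕ}
    (h : ∀ r < t, ∀ y, G.Adj (action G (switchingLoss ℓ) A ω r) y → ℓ r y = ℓ' r y) :
    action G (switchingLoss ℓ) A ω t = action G (switchingLoss ℓ') A ω t := by
  rw [action, action, history_congr h]

theorem measurable_history [Finite V] [DiscreteMeasurableSpace V] (G : Digraph V) (f : LossSeq V)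
    (A : Strategy V Ω) (t : ℕ) : Measurable fun ω => history G f A ω t := by
  induction t with
  | zero => exact measurable_const
  | succ t ih =>
    have hact : Measurable fun ω => A.act t ω (history G f A ω t) :=
      (A.measurable_act t).comp (measurable_id.prodMk ih)
    have hpast : Measurable fun ω => fun i => (history G f A ω t i).1 :=
      measurable_pi_lambda _ fun i => ((measurable_pi_apply i).comp ih).fst
    have hfb : Measurable fun q : (Fin t → V) × V => feedback G f q.1 q.2 := Measurable.of_discrete
    refine measurable_pi_lambda _ fun i => ?_
    refine Fin.lastCases ?_ (fun i => ?_) i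
    · simp only [history, Fin.snoc_last]
      exact hact.prodMk (hfb.comp (hpast.prodMk hact))
    · simp only [history, Fin.snoc_castSucc]
      exact (measurable_pi_apply i).comp ih

theorem measurable_action [Finite V] [DiscreteMeasurableSpace V] (G : Digraph V) (f : LossSeq V)
    (A : Strategy V Ω) (t : ℕ) : Measurable fun ω => action G f A ω t :=
  (A.measurable_act t).comp (measurable_id.prodMk (measurable_history G f A t))

theorem integrable_policyRegret [Finite V] [DiscreteMeasurableSpace V] (G : Digraph V)
    (f : LossSeq V) (A : Strategy V Ω) (P : Measure Ω) [IsFiniteMeasure P] (T : ℕ) :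
    Integrable (fun ω => policyRegret f T (action G f A ω)) P := by
  refine Integrable.sub (integrable_finsetSum _ fun t _ => ?_) (integrable_const _)
  have hm : Measurable fun ω => fun i : Fin (t + 1) => action G f A ω i :=
    measurable_pi_lambda _ fun i => measurable_action G f A i
  obtain ⟨C, hC⟩ := (Set.finite_range fun x => ‖f t x‖).bddAbove
  refine Integrable.of_bound
    ((Measurable.of_discrete (f := f t)).comp hm).aestronglyMeasurable C ?_
  exact Filter.Eventually.of_forall fun ω => hC ⟨_, rfl⟩

end Observations

/-! ### The two randomized environments -/

open Classical in
/-- Losses `b` at `u`, `b + δ` at `v`, and `1` at the other vertices. -/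
noncomputable def twoArmLoss {V : Type*} (u v : V) (δ : ℝ) (b : ℕ → ℝ) : ℕ → V → ℝ :=
  fun t x => if x = u then b t else if x = v then b t + δ else 1

/-- A walk with steps of size `2 * ε` around `1 / 2` up to time `T`. -/
noncomputable def baseLoss (T : ℕ) (ε : ℝ) (ξ : ℕ → ℤ) (t : ℕ) : ℝ :=
  if t < T then 1 / 2 + 2 * ε * dyadicWalk ξ (t + 1) else 1 / 2

theorem twoArmLoss_left {V : Type*} (u v : V) (δ : ℝ) (b : ℕ → ℝ) (t : ℕ) :
    twoArmLoss u v δ b t u = b t := if_pos rfl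

theorem twoArmLoss_right {V : Type*} {u v : V} (h : u ≠ v) (δ : ℝ) (b : ℕ → ℝ) (t : ℕ) :
    twoArmLoss u v δ b t v = b t + δ := by
  rw [twoArmLoss, if_neg h.symm, if_pos rfl]

theorem twoArmLoss_other {V : Type*} {u v x : V} (hu : x ≠ u) (hv : x ≠ v) (δ : ℝ) (b : ℕ → ℝ)
    (t : ℕ) : twoArmLoss u v δ b t x = 1 := by
  rw [twoArmLoss, if_neg hu, if_neg hv]

theorem baseLoss_congr {T : ℕ} {ε : ℝ} {ξ η : ℕ → ℤ} {t : ℕ} (h : ∀ i ≤ t, ξ i = η i) :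
    baseLoss T ε ξ t = baseLoss T ε η t := by
  rw [baseLoss, baseLoss, dyadicWalk_congr fun i hi => h i (by omega)]

theorem abs_baseLoss_sub_le {T N L : ℕ} {ε : ℝ} (hε : 0 ≤ ε) (hT : T < 2 ^ L) {ξ : ℕ → ℤ}
    (hξ : ξ ∈ noiseBox N T) (t : ℕ) : |baseLoss T ε ξ t - 1 / 2| ≤ 2 * ε * (N * L) := by
  rw [baseLoss]
  split_ifs with ht
  · have h : |dyadicWalk ξ (t + 1)| ≤ (N : ℤ) * L :=
      abs_dyadicWalk_le (fun i hi => abs_le.2 (Finset.mem_Icc.1 ((mem_noiseBox.1 hξ).1 i hi)))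
        (by positivity) _ ht (by omega)
    have h' : |(dyadicWalk ξ (t + 1) : ℝ)| ≤ N * L := by exact_mod_cast h
    rw [add_sub_cancel_left, abs_mul, abs_of_nonneg (by positivity)]
    exact mul_le_mul_of_nonneg_left h' (by positivity)
  · rw [sub_self, abs_zero]
    positivity

theorem twoArmLoss_mem_Icc {V : Type*} {u v : V} {T N L : ℕ} {ε δ : ℝ} (hε : 0 ≤ ε)
    (hT : T < 2 ^ L) (hεL : 2 * ε * (N * L) + ε ≤ 1 / 2) (hδ : |δ| ≤ ε) {ξ : ℕ → ℤ}
    (hξ : ξ ∈ noiseBox N T) (t : ℕ) (x : V) :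
    twoArmLoss u v δ (baseLoss T ε ξ) t x ∈ Set.Icc (0 : ℝ) 1 := by
  have h1 := abs_le.1 (abs_baseLoss_sub_le hε hT hξ t)
  have h2 := abs_le.1 hδ
  rw [twoArmLoss]
  split_ifs
  · constructor <;> linarith
  · constructor <;> linarith
  · simp

/-! ### The offset that follows the observations of `v`. -/

section Shift

variable {V : Type*}

open Classical in
/-- Whether `v` is observed in the last of the rounds before time `τ`, as long as there were less
than `m` switches. -/
noncomputable def observes (G : Digraph V) (v : V) (m : ℕ) (X : ℕ → V) : ℕ → ℤ
  | 0 => 0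
  | t + 1 => if G.Adj (X t) v ∧ switchCount X t < m then 1 else 0

theorem observes_mem (G : Digraph V) (v : V) (m : ℕ) (X : ℕ → V) (τ : ℕ) :
    0 ≤ observes G v m X τ ∧ observes G v m X τ ≤ 1 := by
  cases τ with
  | zero => simp [observes]
  | succ t => rw [observes]; split_ifs <;> simp

theorem observes_congr (G : Digraph V) (v : V) (m : ℕ) {X Y : ℕ → V} {τ : ℕ}
    (h : ∀ i < τ, X i = Y i) : observes G v m X τ = observes G v m Y τ := by
  cases τ with
  | zero => rfl
  | succ t =>
    rw [observes, observes, h t (by omega), switchCount_congr fun i hi => h i (by omega)]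

theorem card_observes_changes_le (G : Digraph V) (v : V) (m : ℕ) (X : ℕ → V) (T : ℕ) :
    ((Finset.range T).filter fun τ => observes G v m X (τ + 1) ≠ observes G v m X τ).card ≤
      m + 1 := by
  classical
  -- After time `0` the indicator changes only at a switch preceded by fewer than `m` others, which
  -- includes its final drop to `0`. The extra `1` is a possible change at `τ = 0`.
  set S := (Finset.range T).filter fun r => X (r + 1) ≠ X r ∧ switchCount X r < m with hS
  have hsub : ((Finset.range T).filter
      fun τ => observes G v m X (τ + 1) ≠ observes G v m X τ) ⊆ insert 0 (S.image (· + 1)) := by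
    intro τ hτ
    rw [Finset.mem_filter, Finset.mem_range] at hτ
    cases τ with
    | zero => simp
    | succ r =>
      refine Finset.mem_insert_of_mem (Finset.mem_image.2 ⟨r, ?_, rfl⟩)
      rw [hS, Finset.mem_filter, Finset.mem_range]
      have hne : X (r + 1) ≠ X r := fun h => hτ.2 (by
        rw [observes, observes, switchCount_succ_of_eq h, h])
      refine ⟨by omega, hne, ?_⟩
      by_contra hm
      refine hτ.2 ?_
      rw [observes, observes, switchCount_succ_of_ne hne, if_neg (by omega), if_neg (by omega)]
  have hcard : S.card ≤ m := by
    rw [← Finset.card_range m]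
    have hlt : ∀ r ∈ S, ∀ r', r < r' → switchCount X r < switchCount X r' := fun r hr r' h => by
      have h1 := switchCount_succ_of_ne (Finset.mem_filter.1 hr).2.1
      have h2 := switchCount_mono X (show r + 1 ≤ r' from h)
      omega
    refine Finset.card_le_card_of_injOn (switchCount X) (fun r hr => ?_) fun r hr r' hr' h => ?_
    · simpa using (Finset.mem_filter.1 hr).2.2
    · rcases lt_trichotomy r r' with h1 | h1 | h1
      · exact absurd h (hlt r hr r' h1).ne
      · exact h1
      · exact absurd h (hlt r' hr' r h1).ne'
  calc _ ≤ _ := Finset.card_le_card hsub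
    _ ≤ _ := Finset.card_insert_le _ _
    _ ≤ m + 1 := Nat.add_le_add_right (Finset.card_image_le.trans hcard) 1

end Shift

/-! ### Average regret over the two environments. -/

section LowerBound

variable {V Ω : Type*} [Finite V] [MeasurableSpace V] [MeasurableSpace Ω]

/-- For a fixed value of the player's randomness, the average regret over the noise in the two
environments `δ = ε` and `δ = -ε`. -/
theorem le_average_regret {G : Digraph V} {u v : V} (huv : u ≠ v)
    (hdisj : ∀ w, G.Adj w u → ¬ G.Adj w v) (A : Strategy V Ω) (ω : Ω) {n N L m : ℕ} {ε h : ℝ}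
    {g : ℤ → ℝ} (hg : ∀ k, 0 ≤ g k) (hsupp : ∀ k, g k ≠ 0 → k ∈ Finset.Icc (-(N : ℤ)) N)
    (h1 : ∑ k ∈ Finset.Icc (-(N : ℤ)) N, g k ^ 2 = 1) (hh0 : 0 ≤ h) (hh1 : h ≤ 1)
    (hr : ∀ σ : ℤ, |σ| = 1 → 1 - h ≤ ∑ k ∈ Finset.Icc (-(N : ℤ)) N, g k * g (k + σ))
    (hT : n + 1 < 2 ^ L) (hε : 0 ≤ ε) (hεL : 2 * ε * (N * L) + ε ≤ 1 / 2)
    (hBh : (((m + 1) * L : ℕ) : ℝ) * h ≤ 1 / 2) :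
    min (m : ℝ) (ε * (n + 1 : ℕ) / 2) / 8 ≤
      ∑ ξ ∈ noiseBox N (n + 1), (∏ t ∈ Finset.range (n + 1), g (ξ t) ^ 2) *
        (policyRegret (switchingLoss (twoArmLoss u v ε (baseLoss (n + 1) ε ξ))) (n + 1)
            (action G (switchingLoss (twoArmLoss u v ε (baseLoss (n + 1) ε ξ))) A ω) +
          policyRegret (switchingLoss (twoArmLoss u v (-ε) (baseLoss (n + 1) ε ξ))) (n + 1)
            (action G (switchingLoss (twoArmLoss u v (-ε) (baseLoss (n + 1) ε ξ))) A ω)) := by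
  classical
  set T := n + 1 with hTn
  set X : ℝ → (ℕ → ℤ) → ℕ → V := fun δ ξ =>
    action G (switchingLoss (twoArmLoss u v δ (baseLoss T ε ξ))) A ω with hX
  set d : (ℕ → ℤ) → ℕ → ℤ := fun ξ => observes G v m (X (-ε) ξ) with hd
  set s : ℕ → (ℕ → ℤ) → ℤ := fun t ξ =>
    if t < T then d ξ (dyadicParent (t + 1)) - d ξ (t + 1) else 0 with hs
  have hXpred : ∀ t ξ η, (∀ i < t, ξ i = η i) → X (-ε) ξ t = X (-ε) η t := fun t ξ η hξη =>
    action_congr fun r hr y _ => by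
      rw [twoArmLoss, twoArmLoss, baseLoss_congr fun i hi => hξη i (by omega)]
  -- `d (t + 1)` reads the action of round `t`, which depends only on losses of earlier rounds and
  -- so only on the noise before `t`.
  have hspred : Predictable s := fun t ξ η hξη => by
    have hX' : ∀ i < t + 1, X (-ε) ξ i = X (-ε) η i := fun i hi =>
      hXpred i ξ η fun j hj => hξη j (by omega)
    have hp := dyadicParent_succ_le t
    simp only [hs, hd]
    rw [observes_congr G v m hX', observes_congr G v m fun i hi => hX' i (by omega)]
  have hs1 : ∀ t ξ, |s t ξ| ≤ 1 := fun t ξ => by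
    have h1 := observes_mem G v m (X (-ε) ξ) (dyadicParent (t + 1))
    have h2 := observes_mem G v m (X (-ε) ξ) (t + 1)
    simp only [hs, hd]
    split_ifs
    · rw [abs_le]
      omega
    · simp
  have hB : ∀ ξ, ((Finset.range T).filter fun t => s t ξ ≠ 0).card ≤ (m + 1) * L := fun ξ => by
    refine le_trans (Finset.card_le_card fun t ht => ?_)
      (card_dyadic_increments_le hT (d ξ) (card_observes_changes_le G v m (X (-ε) ξ) T))
    rw [Finset.mem_filter, Finset.mem_range] at ht ⊢
    refine ⟨ht.1, ?_⟩
    simpa only [hs, if_pos ht.1] using ht.2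
  -- The slack `ε` in `hεL` keeps the loss `1` of the other vertices at least `ε` above the best
  -- one.
  have hRA : ∀ ξ ∈ noiseBox N T,
      ε * ((Finset.range T).filter fun t => X ε ξ t ≠ u).card + switchCount (X ε ξ) n ≤
        policyRegret (switchingLoss (twoArmLoss u v ε (baseLoss T ε ξ))) T (X ε ξ) :=
    fun ξ hξ => le_policyRegret fun t _ x hx => by
      have hb := abs_le.1 (abs_baseLoss_sub_le hε hT hξ t)
      rw [twoArmLoss_left]
      by_cases hxv : x = v
      · rw [hxv, twoArmLoss_right huv]
        linarith
      · rw [twoArmLoss_other hx hxv]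
        linarith
  have hRB : ∀ ξ ∈ noiseBox N T,
      ε * ((Finset.range T).filter fun t => X (-ε) ξ t ≠ v).card + switchCount (X (-ε) ξ) n ≤
        policyRegret (switchingLoss (twoArmLoss u v (-ε) (baseLoss T ε ξ))) T (X (-ε) ξ) :=
    fun ξ hξ => le_policyRegret fun t _ x hx => by
      have hb := abs_le.1 (abs_baseLoss_sub_le hε hT hξ t)
      rw [twoArmLoss_right huv]
      by_cases hxu : x = u
      · rw [hxu, twoArmLoss_left]
        linarith
      · rw [twoArmLoss_other hxu hx]
        linarith
  refine two_point_bound (s := s) hg hsupp h1 hh0 hh1 hr hspred hs1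
    (fun t ξ ht => if_neg (by omega)) hB hBh (by positivity)
    (RA := fun ξ => policyRegret (switchingLoss (twoArmLoss u v ε (baseLoss T ε ξ))) T (X ε ξ))
    (RB := fun ξ =>
      policyRegret (switchingLoss (twoArmLoss u v (-ε) (baseLoss T ε ξ))) T (X (-ε) ξ))
    (fun ξ hξ => le_trans (by positivity) (hRA ξ hξ))
    (fun ξ hξ => le_trans (by positivity) (hRB ξ hξ)) fun ξ hξ hψ => ?_
  set ψ : ℕ → ℤ := fun t => ξ t + s t ξ with hψdef
  refine Or.imp (fun h => le_trans h (hRB ξ hξ)) (fun h => le_trans h (hRA ψ hψ)) ?_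
  rcases le_or_gt m (switchCount (X (-ε) ξ) n) with hm | hm
  · left
    have hm' : (m : ℝ) ≤ switchCount (X (-ε) ξ) n := by exact_mod_cast hm
    have : 0 ≤ ε * ((Finset.range T).filter fun t => X (-ε) ξ t ≠ v).card := by positivity
    exact (min_le_left _ _).trans (by linarith)
  have hwalk : ∀ r < T, dyadicWalk ψ (r + 1) = dyadicWalk ξ (r + 1) - d ξ (r + 1) := fun r hr =>
    dyadicWalk_shift (d := d ξ) rfl fun t ht => by
      simp only [hψdef, hs, if_pos (show t < T by omega)]
  -- Going from `-ε` to `ε` raises `v` by `2ε`, one unit of the walk, and the shift cancels this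
  -- whenever `v` is seen. When `u` is seen, `v` is not, so the base is unshifted.
  have hsame : ∀ t < T, X (-ε) ξ t = X ε ψ t := fun t ht => action_congr fun r hr y hy => by
    have hrT : r < T := by omega
    have hbase : baseLoss T ε ψ r = baseLoss T ε ξ r - 2 * ε * d ξ (r + 1) := by
      rw [baseLoss, baseLoss, if_pos hrT, if_pos hrT, hwalk r hrT]
      push_cast
      ring
    have hsw : switchCount (X (-ε) ξ) r < m :=
      (switchCount_mono _ (show r ≤ n by omega)).trans_lt hm
    by_cases hyu : y = u
    · have hd0 : d ξ (r + 1) = 0 := if_neg fun h => hdisj _ (hyu ▸ hy) h.1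
      rw [hyu, twoArmLoss_left, twoArmLoss_left, hbase, hd0]
      simp
    · by_cases hyv : y = v
      · have hd1 : d ξ (r + 1) = 1 := if_pos ⟨hyv ▸ hy, hsw⟩
        rw [hyv, twoArmLoss_right huv, twoArmLoss_right huv, hbase, hd1]
        push_cast
        ring
      · rw [twoArmLoss_other hyu hyv, twoArmLoss_other hyu hyv]
  -- The common action of a round cannot be both `u` and `v`.
  have hcount : T ≤ ((Finset.range T).filter fun t => X (-ε) ξ t ≠ v).card +
      ((Finset.range T).filter fun t => X ε ψ t ≠ u).card := by
    refine le_trans ?_ (Finset.card_union_le _ _)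
    conv_lhs => rw [← Finset.card_range T]
    refine Finset.card_le_card fun t ht => ?_
    rw [Finset.mem_union, Finset.mem_filter, Finset.mem_filter, ← hsame t (Finset.mem_range.1 ht)]
    by_cases h : X (-ε) ξ t = v
    · exact Or.inr ⟨ht, by rw [h]; exact huv.symm⟩
    · exact Or.inl ⟨ht, h⟩
  have hcount' : (T : ℝ) ≤ ((Finset.range T).filter fun t => X (-ε) ξ t ≠ v).card +
      ((Finset.range T).filter fun t => X ε ψ t ≠ u).card := by exact_mod_cast hcount
  have e1 : (0 : ℝ) ≤ switchCount (X (-ε) ξ) n := Nat.cast_nonneg _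
  have e2 : (0 : ℝ) ≤ switchCount (X ε ψ) n := Nat.cast_nonneg _
  rcases le_total ((T : ℝ) / 2) ((Finset.range T).filter fun t => X (-ε) ξ t ≠ v).card with hc | hc
  · left
    have := mul_le_mul_of_nonneg_left hc hε
    exact (min_le_right _ _).trans (by linarith)
  · right
    have := mul_le_mul_of_nonneg_left (show (T : ℝ) / 2 ≤
      ((Finset.range T).filter fun t => X ε ψ t ≠ u).card by linarith) hε
    exact (min_le_right _ _).trans (by linarith)

/-- Averaging: if all losses gave less than `K / 16`, the weighted sum over both environments would
be below `K / 8`, against the integral over `ω` of `le_average_regret`. -/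
theorem exists_loss_le_expectedRegret [DiscreteMeasurableSpace V] {G : Digraph V} {u v : V}
    (huv : u ≠ v) (hdisj : ∀ w, G.Adj w u → ¬ G.Adj w v) (P : Measure Ω) [IsProbabilityMeasure P]
    (A : Strategy V Ω) {T N L m : ℕ} {ε : ℝ} (hT0 : 1 ≤ T) (hN : 1 ≤ N) (hT : T < 2 ^ L)
    (hε : 0 ≤ ε) (hεL : 2 * ε * (N * L) + ε ≤ 1 / 2) (hm : (m + 1) * L * 10 ≤ N ^ 2) :
    ∃ ℓ : ℕ → V → ℝ, (∀ t x, ℓ t x ∈ Set.Icc (0 : ℝ) 1) ∧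
      min (m : ℝ) (ε * T / 2) / 16 ≤ expectedRegret G (switchingLoss ℓ) T A P := by
  obtain ⟨n, rfl⟩ : ∃ n, T = n + 1 := ⟨T - 1, by omega⟩
  obtain ⟨g, hg, hsupp, h1, hr⟩ := exists_smooth_profile hN
  have hN2 : (0 : ℝ) < (N : ℝ) ^ 2 := by positivity
  have hL : 1 ≤ L := by
    rcases Nat.eq_zero_or_pos L with rfl | h
    · simp at hT
    · exact h
  have hm' : (((m + 1) * L : ℕ) : ℝ) * 10 ≤ (N : ℝ) ^ 2 := by exact_mod_cast hm
  have hmL : (1 : ℝ) ≤ (((m + 1) * L : ℕ) : ℝ) := by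
    exact_mod_cast Nat.one_le_iff_ne_zero.2 (Nat.mul_ne_zero (by omega) (by omega))
  have hBh : (((m + 1) * L : ℕ) : ℝ) * (5 / (N : ℝ) ^ 2) ≤ 1 / 2 := by
    rw [← mul_div_assoc, div_le_iff₀ hN2]
    linarith
  have hh1 : 5 / (N : ℝ) ^ 2 ≤ 1 := by
    rw [div_le_one hN2]
    linarith
  set K := min (m : ℝ) (ε * (n + 1 : ℕ) / 2) with hK
  by_contra! hcon
  set E : ℝ → (ℕ → ℤ) → ℝ := fun δ ξ =>
    expectedRegret G (switchingLoss (twoArmLoss u v δ (baseLoss (n + 1) ε ξ))) (n + 1) A P with hE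
  set w : (ℕ → ℤ) → ℝ := fun ξ => ∏ t ∈ Finset.range (n + 1), g (ξ t) ^ 2 with hw
  have hEA : ∀ ξ ∈ noiseBox N (n + 1), E ε ξ < K / 16 := fun ξ hξ =>
    hcon _ (twoArmLoss_mem_Icc hε hT hεL (abs_of_nonneg hε).le hξ)
  have hEB : ∀ ξ ∈ noiseBox N (n + 1), E (-ε) ξ < K / 16 := fun ξ hξ =>
    hcon _ (twoArmLoss_mem_Icc hε hT hεL (by rw [abs_neg, abs_of_nonneg hε]) hξ)
  have hint : K / 8 ≤ ∑ ξ ∈ noiseBox N (n + 1), w ξ * (E ε ξ + E (-ε) ξ) := by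
    have hi := fun δ ξ => integrable_policyRegret G
      (switchingLoss (twoArmLoss u v δ (baseLoss (n + 1) ε ξ))) A P (n + 1)
    have h2 := integral_mono (μ := P) (integrable_const (K / 8))
      (integrable_finsetSum (noiseBox N (n + 1)) fun ξ _ =>
        ((hi ε ξ).add (hi (-ε) ξ)).const_mul (w ξ)) fun ω =>
      le_average_regret huv hdisj A ω hg hsupp h1 (by positivity) hh1 hr hT hε hεL hBh
    rw [integral_const, probReal_univ, one_smul,
      integral_finsetSum _ fun ξ _ => ((hi ε ξ).add (hi (-ε) ξ)).const_mul (w ξ)] at h2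
    refine h2.trans_eq (Finset.sum_congr rfl fun ξ _ => ?_)
    rw [integral_const_mul]
    congr 1
    exact integral_add (hi ε ξ) (hi (-ε) ξ)
  have hmass : ∑ ξ ∈ noiseBox N (n + 1), w ξ = 1 :=
    sum_noiseBox_prod N (n + 1) (fun k => g k ^ 2) h1
  have hw0 : ∀ ξ, 0 ≤ w ξ := fun ξ => Finset.prod_nonneg fun _ _ => sq_nonneg _
  obtain ⟨ξ₀, hξ₀, hpos⟩ : ∃ ξ ∈ noiseBox N (n + 1), 0 < w ξ := by
    by_contra! hc
    have := Finset.sum_nonpos hc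
    linarith
  have hlt : ∑ ξ ∈ noiseBox N (n + 1), w ξ * (E ε ξ + E (-ε) ξ) <
      ∑ ξ ∈ noiseBox N (n + 1), w ξ * (K / 8) := by
    refine Finset.sum_lt_sum (fun ξ hξ => mul_le_mul_of_nonneg_left ?_ (hw0 ξ))
      ⟨ξ₀, hξ₀, mul_lt_mul_of_pos_left ?_ hpos⟩
    · linarith [hEA ξ hξ, hEB ξ hξ]
    · linarith [hEA ξ₀ hξ₀, hEB ξ₀ hξ₀]
  rw [← Finset.sum_mul, hmass, one_mul] at hlt
  linarith

end LowerBound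

/-! ### The pair of vertices and the choice of parameters. -/

/-- A non-revealing strongly observable graph has two vertices that are never observed
together. -/
theorem exists_disjoint_of_not_revealing {V : Type*} [Nontrivial V] {G : Digraph V}
    (hG : StronglyObservable G) (hR : ¬ Revealing G) :
    ∃ u v : V, u ≠ v ∧ ∀ w, G.Adj w u → ¬ G.Adj w v := by
  unfold Revealing at hR
  push Not at hR
  obtain ⟨u, v, huv⟩ := hR
  have hdisj : ∀ w, G.Adj w u → ¬ G.Adj w v := fun w h1 h2 =>
    (Set.eq_empty_iff_forall_notMem.1 huv w) ⟨h1, h2⟩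
  refine ⟨u, v, ?_, hdisj⟩
  rintro rfl
  obtain ⟨w, hw⟩ := exists_ne u
  rcases hG u with h | h
  · have : G.Adj u u := h rfl
    exact hdisj u this this
  · have : G.Adj w u := h ⟨trivial, hw⟩
    exact hdisj w this this

theorem eventually_log_mul_le_rpow :
    ∀ᶠ T : ℕ in Filter.atTop, 200 * Real.log T ≤ (T : ℝ) ^ ((2 : ℝ) / 3) := by
  have h := (isLittleO_log_rpow_atTop (r := (2 : ℝ) / 3) (by norm_num)).comp_tendsto
    tendsto_natCast_atTop_atTop
  filter_upwards [h.bound (c := 1 / 200) (by norm_num)] with T hT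
  simp only [Function.comp_apply, Real.norm_eq_abs] at hT
  rw [abs_of_nonneg (a := (T : ℝ) ^ ((2 : ℝ) / 3)) (by positivity)] at hT
  linarith [le_abs_self (Real.log T)]

/-- Admissible parameters for the two environments. -/
theorem exists_parameters {T : ℕ} (hT : 3 ≤ T)
    (hlog : 200 * Real.log T ≤ (T : ℝ) ^ ((2 : ℝ) / 3)) :
    ∃ (N L m : ℕ) (ε : ℝ), 1 ≤ N ∧ T < 2 ^ L ∧ 0 ≤ ε ∧ 2 * ε * (N * L) + ε ≤ 1 / 2 ∧
      (m + 1) * L * 10 ≤ N ^ 2 ∧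
      (T : ℝ) ^ ((2 : ℝ) / 3) / (72 * Real.log T) ≤ min (m : ℝ) (ε * T / 2) := by
  have hT' : (3 : ℝ) ≤ T := by exact_mod_cast hT
  have hlog1 : 1 ≤ Real.log T := by
    rw [Real.le_log_iff_exp_le (by linarith)]
    linarith [Real.exp_one_lt_d9]
  set x : ℝ := (T : ℝ) ^ ((1 : ℝ) / 3) with hx
  have hx1 : 1 ≤ x := Real.one_le_rpow (by linarith) (by norm_num)
  have hx2 : (T : ℝ) ^ ((2 : ℝ) / 3) = x ^ 2 := by
    rw [hx, ← Real.rpow_natCast, ← Real.rpow_mul (by linarith)]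
    norm_num
  have hx3 : (T : ℝ) = x ^ 3 := by
    rw [hx, ← Real.rpow_natCast, ← Real.rpow_mul (by linarith)]
    norm_num
  rw [hx2] at hlog ⊢
  set N := ⌈x⌉₊ with hN
  set L := Nat.log 2 T + 1 with hL
  have hxN : x ≤ N := Nat.le_ceil x
  have hNx : (N : ℝ) ≤ 2 * x := by linarith [Nat.ceil_lt_add_one (show 0 ≤ x by linarith)]
  have hL1 : (1 : ℝ) ≤ L := by
    rw [hL]
    push_cast
    linarith [(Nat.cast_nonneg _ : (0 : ℝ) ≤ Nat.log 2 T)]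
  have hLlog : (L : ℝ) ≤ 3 * Real.log T := by
    have h1 : ((2 : ℝ)) ^ Nat.log 2 T ≤ T := by
      exact_mod_cast Nat.pow_log_le_self 2 (by omega)
    have h2 := Real.log_le_log (by positivity) h1
    rw [Real.log_pow] at h2
    have h3 := Real.log_two_gt_d9
    have h4 : (0 : ℝ) ≤ Nat.log 2 T := Nat.cast_nonneg _
    rw [hL]
    push_cast
    nlinarith
  have hN0 : (0 : ℝ) < N := by linarith
  set q := N ^ 2 / (10 * L) with hq
  have hq1 : (N : ℝ) ^ 2 / (10 * L) < q + 1 := by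
    have := Nat.lt_floor_add_one ((N : ℝ) ^ 2 / (10 * L))
    have e : ⌊(N : ℝ) ^ 2 / (10 * L)⌋₊ = q := by
      have := Nat.floor_div_eq_div (K := ℝ) (N ^ 2) (10 * L)
      push_cast at this
      rw [this]
    rwa [e] at this
  have hq2 : x ^ 2 / (30 * Real.log T) ≤ (N : ℝ) ^ 2 / (10 * L) := by
    gcongr ?_ / ?_
    · nlinarith
    · linarith
  -- The two units pay for the rounding in `q` and for `m = q - 1`.
  have hq3 : x ^ 2 / (72 * Real.log T) + 1 ≤ x ^ 2 / (30 * Real.log T) - 1 := by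
    have e1 : x ^ 2 / (72 * Real.log T) = x ^ 2 / Real.log T / 72 := by
      rw [mul_comm, div_div]
    have e2 : x ^ 2 / (30 * Real.log T) = x ^ 2 / Real.log T / 30 := by
      rw [mul_comm, div_div]
    have e3 : 200 ≤ x ^ 2 / Real.log T := by
      rw [le_div_iff₀ (by linarith)]
      exact hlog
    rw [e1, e2]
    linarith
  have hq4 : x ^ 2 / (72 * Real.log T) + 1 ≤ q := by linarith
  have hq5 : 1 ≤ q := by
    have h0 : 0 ≤ x ^ 2 / (72 * Real.log T) := by positivity
    have : (1 : ℝ) ≤ q := by linarith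
    exact_mod_cast this
  have hNL : (1 : ℝ) ≤ N * L := by nlinarith
  -- `m` and `ε` are the largest values that their constraints allow.
  refine ⟨N, L, q - 1, 1 / (2 * (2 * (N * L) + 1)), Nat.one_le_iff_ne_zero.2 fun h => ?_,
    Nat.lt_pow_succ_log_self (by norm_num) T, by positivity, le_of_eq (by field_simp), ?_,
    le_min ?_ ?_⟩
  · rw [h] at hN0
    simp at hN0
  · rw [Nat.sub_add_cancel hq5]
    calc q * L * 10 = N ^ 2 / (10 * L) * (10 * L) := by rw [hq]; ring
      _ ≤ N ^ 2 := Nat.div_mul_le_self _ _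
  · rw [Nat.cast_sub hq5]
    push_cast
    linarith
  · have h1 : (N : ℝ) * L ≤ 2 * x * (3 * Real.log T) :=
      mul_le_mul hNx hLlog (by linarith) (by linarith)
    -- Source of `72`: `8NL + 4 ≤ 12NL`, and `NL ≤ 6 x log T`.
    have h2 : 2 * (2 * ((N : ℝ) * L) + 1) * 2 ≤ x * (72 * Real.log T) := by linarith
    generalize Real.log T = l at hlog1 h2 ⊢
    rw [hx3, one_div_mul_eq_div, div_div, div_le_div_iff₀ (by positivity) (by positivity)]
    nlinarith [mul_le_mul_of_nonneg_left h2 (sq_nonneg x)]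

end FeedbackGame

theorem theorem4 :
    ∃ (c : ℝ) (p T₀ : ℕ), 0 < c ∧
      ∀ (V : Type*) [Fintype V] [Nontrivial V] [MeasurableSpace V] [DiscreteMeasurableSpace V]
        (G : Digraph V), FeedbackGame.StronglyObservable G → ¬ FeedbackGame.Revealing G →
      ∀ (T : ℕ), T₀ ≤ T →
      ∀ (Ω : Type*) [MeasurableSpace Ω] (P : Measure Ω) [IsProbabilityMeasure P]
        (A : FeedbackGame.Strategy V Ω),
      ∃ ℓ : ℕ → V → ℝ, (∀ t v, ℓ t v ∈ Set.Icc (0 : ℝ) 1) ∧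
        c * (T : ℝ) ^ ((2 : ℝ) / 3) / Real.log T ^ p ≤
          FeedbackGame.expectedRegret G (FeedbackGame.switchingLoss ℓ) T A P := by
  obtain ⟨T₁, hT₁⟩ := Filter.eventually_atTop.1 FeedbackGame.eventually_log_mul_le_rpow
  -- `1152 = 72 * 16`.
  refine ⟨1 / 1152, 1, max 3 T₁, by norm_num, ?_⟩
  intro V _ _ _ _ G hG hR T hT Ω _ P _ A
  obtain ⟨u, v, huv, hdisj⟩ := FeedbackGame.exists_disjoint_of_not_revealing hG hR
  have hT3 : 3 ≤ T := (le_max_left _ _).trans hT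
  obtain ⟨N, L, m, ε, hN, hL, hε, hεL, hm, hK⟩ :=
    FeedbackGame.exists_parameters hT3 (hT₁ T ((le_max_right _ _).trans hT))
  obtain ⟨ℓ, hℓ, hreg⟩ := FeedbackGame.exists_loss_le_expectedRegret huv hdisj P A
    (by omega) hN hL hε hεL hm
  refine ⟨ℓ, hℓ, le_trans ?_ hreg⟩
  rw [pow_one]
  calc 1 / 1152 * (T : ℝ) ^ ((2 : ℝ) / 3) / Real.log T
      = (T : ℝ) ^ ((2 : ℝ) / 3) / (72 * Real.log T) / 16 := by
        rw [div_div, mul_right_comm, one_div_mul_eq_div, div_div, mul_comm (1152 : ℝ)]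
        ring
    _ ≤ _ := by linarith
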